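/- Let $\mathbb F_q$ be a finite field, let $F_1\subsetneq\cdots\subsetneq F_\lambda\subseteq\mathbb F_q$ be subfields, and let $\mu_1,\dots,\mu_\lambda$ be positive integers. Put $s_0=0$, $s_t=\mu_1+\cdots+\mu_t$ for $1\le t\le\lambda$, and $m=s_\lambda\ge 1$. For $1\le k\le m$ let $t_k$ be the unique integer with $s_{t_k-1}<k\le s_{t_k}$, and put $A_k=F_{t_k}$, $d_k=|A_k|$ and $\mathcal A=A_1\times\cdots\times A_m=F_1^{\mu_1}\times\cdots\times F_\lambda^{\mu_\lambda}\subseteq\mathbb F_q^m$. For an integer $u\ge 0$ let $\mathrm{AC}_q(u,\mathcal A)\subseteq\mathbb F_q^{\mathcal A}$ be the affine Cartesian code of order $u$, i.e. the set of all words $(f(P))_{P\in\mathcal A}$, where $f\in\mathbb F_q[X_1,\dots,X_m]$ satisfies $\deg f\le u$ and $\deg_{X_i}f<d_i$ for $1\le i\le m$. A minimum weight codeword is a nonzero codeword whose Hamming weight is least among all nonzero codewords. Let $0\le j<m$, $u=\sum_{i=1}^{j+1}(d_i-1)$ and $r=t_{j+1}$. Then the number of minimum weight codewords of $\mathrm{AC}_q(u,\mathcal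 A)$ is $$(q-1)\Big(\prod_{i=1}^{j+1}d_i\Big)\genfrac{[}{]}{0pt}{}{\mu_r}{j+1-s_{r-1}}_{d_{j+1}},$$ where $\genfrac{[}{]}{0pt}{}{n}{k}_{d}$ denotes the Gaussian binomial coefficient, i.e. the number of $k$-dimensional linear subspaces of $\mathbb F_d^{\,n}$. -/

import Mathlib

/-- `partialSum μ t` is `s_t = μ_1 + ⋯ + μ_t` (the sum of the first `t` block lengths),
so that `partialSum μ 0 = 0`. -/
def partialSum {lam : ℕ} (μ : Fin lam → ℕ) (t : ℕ) : ℕ :=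
  ∑ i : Fin lam with i.val < t, μ i

/-- The coordinate `k` (counted from `0`) lies in the block `t` (counted from `0`).
With both counted from `1` this reads `s_{t-1} < k ≤ s_t`, that is, `t = t_k`. -/
def InBlock {lam m : ℕ} (μ : Fin lam → ℕ) (t : Fin lam) (k : Fin m) : Prop :=
  partialSum μ t.val ≤ k.val ∧ k.val < partialSum μ (t.val + 1)

/-- The space of polynomials of total degree at most `u` whose degree in the `i`-th variable
is less than `d_i = |A_i|` for every `i`. -/
def reducedPolys {F : Type*} [Field F] [Finite F] {m : ℕ} (A : Fin m → Subfield F) (u : ℕ) :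
    Submodule F (MvPolynomial (Fin m) F) where
  carrier := {f | f.totalDegree ≤ u ∧ ∀ i, f.degreeOf i < Nat.card (A i)}
  zero_mem' := ⟨by simp, fun i => by simp⟩
  add_mem' {f g} hf hg :=
    ⟨(MvPolynomial.totalDegree_add f g).trans (max_le hf.1 hg.1),
      fun i => (MvPolynomial.degreeOf_add_le i f g).trans_lt (max_lt (hf.2 i) (hg.2 i))⟩
  smul_mem' a f hf :=
    ⟨(MvPolynomial.totalDegree_smul_le a f).trans hf.1, fun i => by
      rw [MvPolynomial.smul_eq_C_mul]
      exact (MvPolynomial.degreeOf_C_mul_le f i a).trans_lt (hf.2 i)⟩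

/-- Evaluation of polynomials at all the points of `A_1 × ⋯ × A_m`; words are indexed by the
points of this product. -/
noncomputable def evalWord {F : Type*} [Field F] {m : ℕ} (A : Fin m → Subfield F) :
    MvPolynomial (Fin m) F →ₗ[F] (((i : Fin m) → A i) → F) where
  toFun f := fun P => MvPolynomial.eval (fun i => (P i : F)) f
  map_add' f g := by ext P; simp
  map_smul' a f := by ext P; simp [MvPolynomial.smul_eval]

/-- The affine Cartesian code of order `u` on `A_1 × ⋯ × A_m`. -/
noncomputable def affineCartesianCode {F : Type*} [Field F] [Finite F] {m : ℕ} (A : Fin m → Subfield F)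
    (u : ℕ) : Submodule F (((i : Fin m) → A i) → F) :=
  (reducedPolys A u).map (evalWord A)

open Classical in
/-- The Hamming weight of a word indexed by a finite type. -/
noncomputable def wordWeight {ι F : Type*} [Finite ι] [Zero F] (c : ι → F) : ℕ :=
  letI := Fintype.ofFinite ι
  hammingNorm c

/-- The minimum weight codewords of a linear code: the nonzero codewords whose weight is least
among the nonzero codewords. -/
def minWeightWords {ι F : Type*} [Finite ι] [Field F] (C : Submodule F (ι → F)) :
    Set (ι → F) :=
  {c | c ∈ C ∧ c ≠ 0 ∧ ∀ c' ∈ C, c' ≠ 0 → wordWeight c ≤ wordWeight c'}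

/-- The Gaussian binomial coefficient `[n choose k]_{|K|}` for a finite field `K`: the number of
`k`-dimensional linear subspaces of `K^n`. -/
noncomputable def gaussianBinomial (K : Type*) [Field K] (n k : ℕ) : ℕ :=
  Nat.card {W : Submodule K (Fin n → K) // Module.finrank K W = k}

/-! ### Boxes with a large exponent sum -/

/-! The degree bounds in the single variables are harmless, so the code consists of all values of
polynomials of degree at most `u`. Put `v = ∑_{i > j} (d_i - 1)`, so that `u + v = ∑ (d_i - 1)`.
Power sums over finite fields show that a word of degree at most `u` is orthogonal to every monomial
of degree less than `v`.

Let `S` be the support of a nonzero word `f`. The monomials that are standard on `S` for degLex form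
a basis of `F^S`, closed under divisors. As `f` is a nonzero functional on `F^S`, some standard
`x^a` of degree at least `v` is not orthogonal to `f`. All divisors of `x^a` are standard, so `|S| ≥
∏ (a_i + 1)`, and concavity of the logarithm gives `∏ (a_i + 1) ≥ ∏_{i > j} d_i`
(`prod_succ_le_of_sum_le`).

In the case of equality the standard monomials are exactly the divisors of `x^a`, and each `a_i` is
`0` or `d_i - 1`. With `T` the support of `a`, the degLex order makes every coordinate outside `T`
an affine function on `S` of those in `T`; counting shows that `S` is the whole graph. Moreover,
pairing with `x^a` is injective on words of the code supported in `S`, so `f` is determined by `S`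
up to a scalar (`ncard_support_of_mem_polyWords`).

A coordinate with values in a smaller field cannot depend on one that runs freely through a larger
field. Hence `S` is a flat: the coordinates before block `r` are constant, those of block `r` run
through a coset of a subspace `W`, and the later ones are free
(`exists_eq_flat_of_affine_relation`). Conversely, the indicator of such a flat of the right
codimension is a product of Fermat factors of total degree `u`. The formula counts scalars, fixed
coordinates, subspaces `W` and cosets of `W`. -/

lemma mul_log_one_add_lt {x y : ℝ} (hx : 0 < x) (hxy : x < y) :
    x * Real.log (y + 1) < y * Real.log (x + 1) := by
  have h := strictConcaveOn_log_Ioi.secant_strict_mono (a := 1) (x := x + 1) (y := y + 1)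
    (by simp) (by simp; linarith) (by simp; linarith) (by linarith) (by linarith) (by linarith)
  simp only [Real.log_one, sub_zero, add_sub_cancel_right] at h
  rw [div_lt_div_iff₀ (by linarith) hx] at h
  linarith

/-- The excess of `log (a + 1) - log (b + 1)` over its lower bound of slope `log (e + 1) / e`. -/
noncomputable def logExcess (e a b : ℕ) : ℝ :=
  Real.log (a + 1) - Real.log (b + 1) - Real.log (e + 1) / e * (a - b)

/-- By strict concavity `log (x + 1)` lies above its chord over `[0, e]`, with contact only at the
two ends. -/
lemma logExcess_zero_right {e D a : ℕ} (he : 0 < e) (hD : D ≤ e) (ha : a ≤ D) :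
    0 ≤ logExcess e a 0 ∧ (logExcess e a 0 = 0 → a = 0 ∨ (a = D ∧ D = e)) := by
  have he' : (0 : ℝ) < e := by exact_mod_cast he
  rcases Nat.eq_zero_or_pos a with rfl | ha0
  · simp [logExcess]
  rcases (ha.trans hD).lt_or_eq with hlt | heq
  · have h := mul_log_one_add_lt (x := a) (y := e) (by exact_mod_cast ha0) (by exact_mod_cast hlt)
    have : 0 < logExcess e a 0 := by
      unfold logExcess
      simp only [Nat.cast_zero, zero_add, Real.log_one, sub_zero, sub_pos]
      rw [div_mul_eq_mul_div, div_lt_iff₀ he']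
      linarith
    exact ⟨this.le, fun h0 => absurd h0 this.ne'⟩
  · subst heq
    have hDa : D = a := le_antisymm hD ha
    subst hDa
    refine ⟨?_, fun _ => Or.inr ⟨rfl, rfl⟩⟩
    unfold logExcess
    simp [he'.ne']

/-- The chord over `[0, D]` has slope at most that of the chord over `[0, e]`. The excess splits
into the height of `log (a + 1)` above the former chord and the difference of slopes times `D - a`.
-/
lemma logExcess_right {e D a : ℕ} (he : 0 < e) (hD : e ≤ D) (ha : a ≤ D) :
    0 ≤ logExcess e a D ∧ (logExcess e a D = 0 → a = D ∨ (a = 0 ∧ D = e)) := by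
  have he' : (0 : ℝ) < e := by exact_mod_cast he
  have hD' : (0 : ℝ) < D := by exact_mod_cast he.trans_le hD
  rcases ha.lt_or_eq with hlt | rfl
  swap
  · simp [logExcess]
  have hlt' : (0 : ℝ) < D - a := by
    have : (a : ℝ) < D := by exact_mod_cast hlt
    linarith
  have hsplit : logExcess e a D = (Real.log (a + 1) - Real.log (D + 1) / D * a)
      + (Real.log (e + 1) / e - Real.log (D + 1) / D) * (D - a) := by
    unfold logExcess
    field_simp
    ring
  have h1 : 0 ≤ Real.log (a + 1) - Real.log (D + 1) / D * a ∧
      (Real.log (a + 1) - Real.log (D + 1) / D * a = 0 → a = 0) := by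
    rcases Nat.eq_zero_or_pos a with rfl | ha0
    · simp
    have h := mul_log_one_add_lt (x := a) (y := D) (by exact_mod_cast ha0) (by exact_mod_cast hlt)
    have : 0 < Real.log (a + 1) - Real.log (D + 1) / D * a := by
      rw [sub_pos, div_mul_eq_mul_div, div_lt_iff₀ hD']
      linarith
    exact ⟨this.le, fun h0 => absurd h0 this.ne'⟩
  have h2 : 0 ≤ Real.log (e + 1) / e - Real.log (D + 1) / D ∧
      (Real.log (e + 1) / e - Real.log (D + 1) / D = 0 → D = e) := by
    rcases hD.lt_or_eq with hlt | rfl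
    swap
    · simp
    have h := mul_log_one_add_lt (x := e) (y := D) he' (by exact_mod_cast hlt)
    have : 0 < Real.log (e + 1) / e - Real.log (D + 1) / D := by
      rw [sub_pos, div_lt_div_iff₀ hD' he']
      linarith
    exact ⟨this.le, fun h0 => absurd h0 this.ne'⟩
  have h3 := mul_nonneg h2.1 hlt'.le
  rw [hsplit]
  refine ⟨add_nonneg h1.1 h3, fun h0 => Or.inr ?_⟩
  rw [add_eq_zero_iff_of_nonneg h1.1 h3] at h0
  exact ⟨h1.2 h0.1, h2.2 ((mul_eq_zero.mp h0.2).resolve_right hlt'.ne')⟩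

/-- If the `a i ≤ D i` have at least the sum that the largest `D i` (those over `H`) have, then
the box of exponents below `a` has at least as many points as the box over `H`; in the case of
equality `a` is, up to indices with `D i = e`, the exponent supported on `H`. -/
theorem prod_succ_le_of_sum_le {ι : Type*} [Fintype ι] {D a : ι → ℕ} {e : ℕ} (he : 0 < e)
    {H : Finset ι} (hH : ∀ i ∈ H, e ≤ D i) (hL : ∀ i ∉ H, D i ≤ e) (ha : ∀ i, a i ≤ D i)
    (hsum : ∑ i ∈ H, D i ≤ ∑ i, a i) :
    ∏ i ∈ H, (D i + 1) ≤ ∏ i, (a i + 1) ∧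
      (∏ i ∈ H, (D i + 1) = ∏ i, (a i + 1) →
        ∑ i, a i = ∑ i ∈ H, D i ∧ ∀ i, (a i = 0 ∨ a i = D i) ∧
          (D i < e → a i = 0) ∧ (e < D i → a i = D i)) := by
  classical
  -- The extremal exponent: full over `H` and zero elsewhere. The two logarithms are compared with
  -- it index by index.
  set b : ι → ℕ := fun i => if i ∈ H then D i else 0 with hb
  have hbsum : ∑ i, b i = ∑ i ∈ H, D i := by simp [hb, Finset.sum_ite_mem]
  have hbprod : ∏ i, (b i + 1) = ∏ i ∈ H, (D i + 1) := by
    rw [← Finset.prod_subset (Finset.subset_univ H)]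
    · exact Finset.prod_congr rfl fun i hi => by simp [hb, hi]
    · intro i _ hi; simp [hb, hi]
  have key : ∀ i, 0 ≤ logExcess e (a i) (b i) ∧ (logExcess e (a i) (b i) = 0 →
      (a i = 0 ∨ a i = D i) ∧ (D i < e → a i = 0) ∧ (e < D i → a i = D i)) := by
    intro i
    by_cases hi : i ∈ H
    · have h := logExcess_right he (hH i hi) (ha i)
      have hbi : b i = D i := by simp [hb, hi]
      rw [hbi]
      have := hH i hi
      exact ⟨h.1, fun h0 => by have := h.2 h0; omega⟩
    · have h := logExcess_zero_right he (hL i hi) (ha i)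
      have hbi : b i = 0 := by simp [hb, hi]
      rw [hbi]
      have := hL i hi
      exact ⟨h.1, fun h0 => by have := h.2 h0; omega⟩
  have hlog : ∀ c : ι → ℕ, Real.log ((∏ i, (c i + 1) : ℕ) : ℝ) = ∑ i, Real.log (c i + 1) := by
    intro c
    push_cast
    exact Real.log_prod fun i _ => by positivity
  have hρ : 0 < Real.log (e + 1) / e := by
    have he' : (0 : ℝ) < e := by exact_mod_cast he
    exact div_pos (Real.log_pos (by linarith)) he'
  -- The common slope `log (e + 1) / e` turns the difference of the exponent sums into a single
  -- nonnegative term, so equality of the products forces every term to vanish.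
  have htot : Real.log ((∏ i, (a i + 1) : ℕ) : ℝ) - Real.log ((∏ i, (b i + 1) : ℕ) : ℝ) =
      ∑ i, logExcess e (a i) (b i) +
        Real.log (e + 1) / e * ((∑ i, a i : ℕ) - (∑ i, b i : ℕ) : ℝ) := by
    rw [hlog, hlog]
    unfold logExcess
    push_cast
    simp only [Finset.sum_sub_distrib, ← Finset.mul_sum]
    ring
  have hs0 : 0 ≤ ∑ i, logExcess e (a i) (b i) := Finset.sum_nonneg fun i _ => (key i).1
  have hd0 : (0 : ℝ) ≤ (∑ i, a i : ℕ) - (∑ i, b i : ℕ) := by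
    rw [sub_nonneg, hbsum]
    exact_mod_cast hsum
  have hr0 := mul_nonneg hρ.le hd0
  have hpos : ∀ c : ι → ℕ, (0 : ℝ) < ((∏ i, (c i + 1) : ℕ) : ℝ) := fun c => by
    have : 0 < ∏ i, (c i + 1) := Finset.prod_pos fun i _ => Nat.succ_pos _
    exact_mod_cast this
  rw [← hbprod, ← hbsum]
  constructor
  · have : Real.log ((∏ i, (b i + 1) : ℕ) : ℝ) ≤ Real.log ((∏ i, (a i + 1) : ℕ) : ℝ) := by
      linarith
    exact_mod_cast (Real.log_le_log_iff (hpos b) (hpos a)).mp this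
  · intro heq
    rw [heq, sub_self] at htot
    have h1 : ∑ i, logExcess e (a i) (b i) = 0 := by linarith
    have h2 : Real.log (e + 1) / e * ((∑ i, a i : ℕ) - (∑ i, b i : ℕ) : ℝ) = 0 := by linarith
    have h3 := (mul_eq_zero.mp h2).resolve_left hρ.ne'
    refine ⟨by exact_mod_cast sub_eq_zero.mp h3, fun i => (key i).2 ?_⟩
    exact (Finset.sum_eq_zero_iff_of_nonneg fun i _ => (key i).1).mp h1 i (Finset.mem_univ i)

/-! ### Standard monomials of a point of a commutative algebra -/

section Standard

variable {σ K R : Type*} [Field K] [CommRing R] [Algebra K R]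

/-- The value of the monomial with exponent `b` at the point `x`. -/
def monomialValue (x : σ → R) (b : σ →₀ ℕ) : R :=
  b.prod fun i e => x i ^ e

lemma monomialValue_add (x : σ → R) (b c : σ →₀ ℕ) :
    monomialValue x (b + c) = monomialValue x b * monomialValue x c := by
  classical
  exact Finsupp.prod_add_index' (fun _ => pow_zero _) fun _ _ _ => pow_add _ _ _

@[simp]
lemma monomialValue_zero (x : σ → R) : monomialValue x 0 = 1 := Finsupp.prod_zero_index

@[simp]
lemma monomialValue_single (x : σ → R) (i : σ) (n : ℕ) :
    monomialValue x (Finsupp.single i n) = x i ^ n :=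
  Finsupp.prod_single_index (pow_zero _)

variable (K) in
/-- A monomial is standard at `x` if its value is not a linear combination of the values of
smaller monomials. -/
def IsStandard (ord : MonomialOrder σ) (x : σ → R) (b : σ →₀ ℕ) : Prop :=
  monomialValue x b ∉
    Submodule.span K (monomialValue x '' {c | ord.toSyn c < ord.toSyn b})

variable {ord : MonomialOrder σ} {x : σ → R}

/-- Multiplying a reduction of a divisor by the cofactor gives a reduction of the multiple, since a
monomial order is compatible with addition of exponents. -/
lemma IsStandard.of_le {b c : σ →₀ ℕ} (hb : IsStandard K ord x b) (hcb : c ≤ b) :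
    IsStandard K ord x c := by
  intro hc
  obtain ⟨e, rfl⟩ := exists_add_of_le hcb
  apply hb
  rw [monomialValue_add, mul_comm]
  have h := Submodule.mem_map_of_mem (f := LinearMap.mulLeft K (monomialValue x e)) hc
  rw [Submodule.map_span] at h
  refine Submodule.span_mono ?_ h
  rintro _ ⟨_, ⟨a, ha, rfl⟩, rfl⟩
  refine ⟨e + a, ?_, by simp [monomialValue_add]⟩
  simp only [Set.mem_ofPred_eq, map_add] at ha ⊢
  rw [add_comm]
  exact add_lt_add_left ha _

lemma monomialValue_mem_span_standard (b : σ →₀ ℕ) :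
    monomialValue x b ∈ Submodule.span K
      (monomialValue x '' {c | IsStandard K ord x c ∧ ord.toSyn c ≤ ord.toSyn b}) := by
  induction hn : ord.toSyn b using WellFoundedLT.induction generalizing b with
  | ind n ih =>
    subst hn
    by_cases hb : IsStandard K ord x b
    · exact Submodule.subset_span ⟨b, ⟨hb, le_rfl⟩, rfl⟩
    · have hb' := not_not.mp hb
      refine Submodule.span_le.mpr ?_ hb'
      rintro _ ⟨c, hc, rfl⟩
      refine Submodule.span_mono ?_ (ih _ hc c rfl)
      exact Set.image_mono fun e he => ⟨he.1, he.2.trans (le_of_lt hc)⟩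

/-- In a linear relation the largest monomial would be a combination of smaller ones. -/
lemma linearIndepOn_standard (s : Finset (σ →₀ ℕ)) (hs : ∀ b ∈ s, IsStandard K ord x b) :
    LinearIndepOn K (monomialValue x) (s : Set (σ →₀ ℕ)) := by
  classical
  induction s using Finset.induction_on_max_value ord.toSyn with
  | empty => simp
  | insert a s has hmax ih =>
    rw [Finset.coe_insert]
    refine (ih fun b hb => hs b (Finset.mem_insert_of_mem hb)).insert fun hmem => ?_
    refine hs a (Finset.mem_insert_self a s) (Submodule.span_mono (Set.image_mono ?_) hmem)
    intro c hc
    refine lt_of_le_of_ne (hmax c hc) fun h => has ?_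
    rwa [← ord.toSyn.injective h]

lemma card_standard_le [Module.Finite K R] (s : Finset (σ →₀ ℕ))
    (hs : ∀ b ∈ s, IsStandard K ord x b) : s.card ≤ Module.finrank K R := by
  have h := (linearIndepOn_standard s hs).fintype_card_le_finrank
  simpa using h

/-- If `x i ^ d = x i` with `2 ≤ d`, standard exponents at `i` are less than `d`. -/
lemma IsStandard.lt_of_pow_eq {b : σ →₀ ℕ} (hb : IsStandard K ord x b) {i : σ} {d : ℕ}
    (hd : 2 ≤ d) (hx : x i ^ d = x i) : b i < d := by
  by_contra! h
  have hstd : IsStandard K ord x (Finsupp.single i d) :=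
    hb.of_le (Finsupp.single_le_iff.mpr h)
  apply hstd
  refine Submodule.subset_span ⟨Finsupp.single i 1, ?_, by simp [hx]⟩
  refine ord.toSyn_strictMono ?_
  refine lt_of_le_of_ne (Finsupp.single_le_single.mpr (by omega)) fun h => ?_
  have := DFunLike.congr_fun h i
  simp at this
  omega

end Standard

/-! ### Words that are values of polynomials of bounded degree -/

section Words

variable {F : Type*} [Field F] {m : ℕ} (A : Fin m → Subfield F)

lemma Subfield.two_le_natCard [Finite F] (K : Subfield F) : 2 ≤ Nat.card K :=
  Finite.one_lt_card

lemma Subfield.pow_natCard [Finite F] {K : Subfield F} {x : F} (hx : x ∈ K) :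
    x ^ Nat.card K = x := by
  have := Fintype.ofFinite K
  have h := FiniteField.pow_card (⟨x, hx⟩ : K)
  rw [Nat.card_eq_fintype_card]
  simpa using congrArg Subtype.val h

lemma Subfield.one_sub_pow_natCard_sub_one [Finite F] [DecidableEq F] {K : Subfield F} {x : F}
    (hx : x ∈ K) : 1 - x ^ (Nat.card K - 1) = if x = 0 then 1 else 0 := by
  have h2 := K.two_le_natCard
  split_ifs with h
  · rw [h, zero_pow (by omega), sub_zero]
  · have hp := Subfield.pow_natCard hx
    rw [show Nat.card K = (Nat.card K - 1) + 1 by omega, pow_succ] at hp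
    rw [sub_eq_zero]
    exact (mul_right_cancel₀ h (by rw [hp, one_mul])).symm

/-- The words given by polynomials of total degree at most `n`. -/
noncomputable def polyWords (n : ℕ) : Submodule F (((i : Fin m) → A i) → F) :=
  (MvPolynomial.restrictTotalDegree (Fin m) F n).map (evalWord A)

variable {A}

lemma mem_polyWords {n : ℕ} {f : ((i : Fin m) → A i) → F} :
    f ∈ polyWords A n ↔ ∃ p : MvPolynomial (Fin m) F, p.totalDegree ≤ n ∧ evalWord A p = f := by
  simp [polyWords, MvPolynomial.mem_restrictTotalDegree]

lemma evalWord_mul (p q : MvPolynomial (Fin m) F) :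
    evalWord A (p * q) = evalWord A p * evalWord A q := by
  ext P; simp [evalWord]

lemma polyWords_mono {n k : ℕ} (h : n ≤ k) : polyWords A n ≤ polyWords A k := by
  intro f hf
  obtain ⟨p, hp, rfl⟩ := mem_polyWords.mp hf
  exact mem_polyWords.mpr ⟨p, hp.trans h, rfl⟩

lemma mul_mem_polyWords {n k : ℕ} {f g : ((i : Fin m) → A i) → F} (hf : f ∈ polyWords A n)
    (hg : g ∈ polyWords A k) : f * g ∈ polyWords A (n + k) := by
  obtain ⟨p, hp, rfl⟩ := mem_polyWords.mp hf
  obtain ⟨q, hq, rfl⟩ := mem_polyWords.mp hg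
  exact mem_polyWords.mpr ⟨p * q, (MvPolynomial.totalDegree_mul p q).trans (add_le_add hp hq),
    evalWord_mul p q⟩

lemma const_mem_polyWords (c : F) : (fun _ => c) ∈ polyWords A 0 :=
  mem_polyWords.mpr ⟨MvPolynomial.C c, by simp, by ext; simp [evalWord]⟩

lemma one_mem_polyWords : (1 : ((i : Fin m) → A i) → F) ∈ polyWords A 0 :=
  const_mem_polyWords 1

lemma coord_mem_polyWords (i : Fin m) : (fun P => (P i : F)) ∈ polyWords A 1 :=
  mem_polyWords.mpr ⟨MvPolynomial.X i, by simp, by ext; simp [evalWord]⟩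

lemma pow_mem_polyWords {n : ℕ} {f : ((i : Fin m) → A i) → F} (hf : f ∈ polyWords A n) (k : ℕ) :
    f ^ k ∈ polyWords A (k * n) := by
  induction k with
  | zero => simpa using one_mem_polyWords (A := A)
  | succ k ih =>
    rw [pow_succ, Nat.succ_mul]
    exact mul_mem_polyWords ih hf

lemma prod_mem_polyWords {ι : Type*} (s : Finset ι) {n : ι → ℕ}
    {f : ι → ((i : Fin m) → A i) → F} (hf : ∀ i ∈ s, f i ∈ polyWords A (n i)) :
    ∏ i ∈ s, f i ∈ polyWords A (∑ i ∈ s, n i) := by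
  classical
  induction s using Finset.induction_on with
  | empty => simpa using one_mem_polyWords (A := A)
  | insert a s ha ih =>
    rw [Finset.prod_insert ha, Finset.sum_insert ha]
    exact mul_mem_polyWords (hf a (Finset.mem_insert_self a s))
      (ih fun i hi => hf i (Finset.mem_insert_of_mem hi))

/-- Lowering the exponent by `d - 1` while it is at least `d` never reaches `0` from a positive
exponent, so `x = 0` needs no exception. -/
lemma exists_reduced_exponent {d : ℕ} (hd : 2 ≤ d) (a : ℕ) :
    ∃ b ≤ a, b < d ∧ ∀ x : F, x ^ d = x → x ^ b = x ^ a := by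
  induction a using Nat.strong_induction_on with
  | _ a ih =>
    rcases lt_or_ge a d with h | h
    · exact ⟨a, le_rfl, h, fun _ _ => rfl⟩
    · obtain ⟨b, hb, hbd, hx⟩ := ih (a - d + 1) (by omega)
      refine ⟨b, by omega, hbd, fun x hxd => ?_⟩
      rw [hx x hxd, pow_succ]
      nth_rewrite 2 [← hxd]
      rw [← pow_add, Nat.sub_add_cancel h]

/-- Reducing exponents modulo `X_i ^ d_i - X_i` shows that the degree bounds in the single
variables do not change the code. -/
theorem affineCartesianCode_eq_polyWords [Finite F] (u : ℕ) :
    affineCartesianCode A u = polyWords A u := by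
  apply le_antisymm
  · rintro _ ⟨p, hp, rfl⟩
    exact mem_polyWords.mpr ⟨p, hp.1, rfl⟩
  · intro f hf
    obtain ⟨p, hp, rfl⟩ := mem_polyWords.mp hf
    rw [p.as_sum, map_sum]
    refine Submodule.sum_mem _ fun a ha => ?_
    choose b hba hbd hb using fun i =>
      exists_reduced_exponent (F := F) (A i).two_le_natCard (a i)
    refine ⟨MvPolynomial.monomial (Finsupp.equivFunOnFinite.symm b) (p.coeff a), ⟨?_, ?_⟩, ?_⟩
    · refine (MvPolynomial.totalDegree_monomial_le _ _).trans (le_trans ?_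
        ((MvPolynomial.le_totalDegree ha).trans hp))
      rw [Finsupp.sum_fintype _ _ fun _ => rfl, Finsupp.sum_fintype _ _ fun _ => rfl]
      exact Finset.sum_le_sum fun i _ => hba i
    · intro i
      refine lt_of_le_of_lt ?_ (hbd i)
      rw [MvPolynomial.degreeOf_le_iff]
      intro e he
      have := MvPolynomial.support_monomial_subset he
      rw [Finset.mem_singleton] at this
      simp [this]
    · ext P
      simp only [evalWord, LinearMap.coe_mk, AddHom.coe_mk, MvPolynomial.eval_monomial]
      rw [Finsupp.prod_fintype _ _ fun _ => pow_zero _, Finsupp.prod_fintype _ _ fun _ => pow_zero _]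
      congr 1
      exact Finset.prod_congr rfl fun i _ => hb i _ (Subfield.pow_natCard (P i).2)

/-- The coordinate functions on a set of points. -/
def coordOn (S : Set ((i : Fin m) → A i)) (i : Fin m) : S → F := fun P => (P.1 i : F)

lemma monomialValue_coordOn (S : Set ((i : Fin m) → A i)) (b : Fin m →₀ ℕ) (P : S) :
    monomialValue (coordOn S) b P = ∏ i, (P.1 i : F) ^ b i := by
  rw [monomialValue, Finsupp.prod_fintype _ _ fun _ => pow_zero _, Finset.prod_apply]
  rfl

/-- The sum factors over the coordinates. Some exponent is below `d_i - 1`, and the corresponding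
power sum over `A i` is zero. -/
lemma sum_prod_pow_eq_zero [∀ i, Fintype (A i)] (b : Fin m → ℕ)
    (hb : ∑ i, b i < ∑ i, (Nat.card (A i) - 1)) :
    ∑ P : (i : Fin m) → A i, ∏ i, (P i : F) ^ b i = 0 := by
  classical
  obtain ⟨i, -, hi⟩ := Finset.exists_lt_of_sum_lt hb
  have h := Finset.prod_univ_sum (fun i : Fin m => (Finset.univ : Finset (A i)))
    fun i x => (x : F) ^ b i
  rw [Fintype.piFinset_univ] at h
  rw [← h]
  refine Finset.prod_eq_zero (Finset.mem_univ i) ?_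
  have := FiniteField.sum_pow_lt_card_sub_one (A i) (b i) (by rwa [← Nat.card_eq_fintype_card])
  simpa using congrArg Subtype.val this

/-- Words of degree at most `u` are orthogonal to monomials of small degree. -/
lemma sum_mul_prod_pow_eq_zero [∀ i, Fintype (A i)] {u : ℕ}
    {f : ((i : Fin m) → A i) → F} (hf : f ∈ polyWords A u) (b : Fin m → ℕ)
    (hb : u + ∑ i, b i < ∑ i, (Nat.card (A i) - 1)) :
    ∑ P : (i : Fin m) → A i, f P * ∏ i, (P i : F) ^ b i = 0 := by
  obtain ⟨p, hp, rfl⟩ := mem_polyWords.mp hf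
  simp only [evalWord, LinearMap.coe_mk, AddHom.coe_mk, MvPolynomial.eval_eq', Finset.sum_mul]
  rw [Finset.sum_comm]
  refine Finset.sum_eq_zero fun a ha => ?_
  simp only [mul_assoc, ← Finset.mul_sum, ← Finset.prod_mul_distrib, ← pow_add]
  rw [sum_prod_pow_eq_zero, mul_zero]
  have h := MvPolynomial.le_totalDegree ha
  rw [Finsupp.sum_fintype _ _ fun _ => rfl] at h
  rw [Finset.sum_add_distrib]
  omega

lemma mem_span_monomialValue_coordOn [Finite F] (S : Set ((i : Fin m) → A i)) (g : S → F) :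
    g ∈ Submodule.span F (Set.range (monomialValue (coordOn S))) := by
  classical
  have := Fintype.ofFinite F
  have hinj : Function.Injective fun (P : S) (i : Fin m) => (P.1 i : F) := by
    intro P Q h
    ext i
    exact congrFun h i
  -- Every function on `F^m` is polynomial; this is applied to the extension of `g` by zero.
  obtain ⟨p, -, hp⟩ := (MvPolynomial.map_restrict_dom_evalₗ F (Fin m)).ge
    (Submodule.mem_top (x := Function.extend (fun (P : S) (i : Fin m) => (P.1 i : F)) g 0))
  have hg : g = ∑ a ∈ p.support, p.coeff a • monomialValue (coordOn S) a := by
    ext P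
    rw [← hinj.extend_apply g 0 P, ← hp, MvPolynomial.evalₗ_apply, MvPolynomial.eval_eq',
      Finset.sum_apply]
    exact Finset.sum_congr rfl fun a _ => by
      rw [Pi.smul_apply, smul_eq_mul, monomialValue_coordOn]
  rw [hg]
  exact Submodule.sum_mem _ fun a _ => Submodule.smul_mem _ _ (Submodule.subset_span ⟨a, rfl⟩)

/-- A function on `S` that is orthogonal to the standard monomials vanishes. -/
lemma eq_zero_of_orthogonal_standard [Finite F] (ord : MonomialOrder (Fin m))
    (S : Set ((i : Fin m) → A i)) [Fintype S] (h : S → F)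
    (hh : ∀ b, IsStandard F ord (coordOn S) b →
      ∑ P, h P * monomialValue (coordOn S) b P = 0) : h = 0 := by
  classical
  let ℓ : (S → F) →ₗ[F] F := ∑ P, h P • LinearMap.proj P
  have hℓ : ∀ g, ℓ g = ∑ P, h P * g P := fun g => by simp [ℓ, LinearMap.sum_apply]
  have hall : ∀ g, ℓ g = 0 := by
    intro g
    have hle : Submodule.span F (Set.range (monomialValue (coordOn S))) ≤ LinearMap.ker ℓ := by
      rw [Submodule.span_le]
      rintro _ ⟨b, rfl⟩
      refine Submodule.span_le.mpr ?_ (monomialValue_mem_span_standard (K := F) (ord := ord) b)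
      rintro _ ⟨c, hc, rfl⟩
      exact (hℓ _).trans (hh c hc.1)
    exact hle (mem_span_monomialValue_coordOn S g)
  ext P
  have := hall (Pi.single P 1)
  rw [hℓ] at this
  simpa [Pi.single_apply] using this

lemma sum_support_mul [∀ i, Fintype (A i)] {S : Set ((i : Fin m) → A i)} [Fintype S]
    {f : ((i : Fin m) → A i) → F} (hf : Function.support f ⊆ S) (b : Fin m →₀ ℕ) :
    ∑ P : S, f P * monomialValue (coordOn S) b P =
      ∑ P : (i : Fin m) → A i, f P * ∏ i, (P i : F) ^ b i := by
  classical
  simp only [monomialValue_coordOn]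
  rw [← Finset.sum_subset (Finset.subset_univ S.toFinset)]
  · exact (Finset.sum_subtype S.toFinset (by simp)
      fun P => f P * ∏ i, (P i : F) ^ b i).symm
  · intro P _ hP
    have : f P = 0 := by
      by_contra h
      exact hP (by simpa using hf h)
    rw [this, zero_mul]

end Words

/-! ### Words of small weight -/

section SmallWeight

variable {F : Type*} [Field F] {m : ℕ} {A : Fin m → Subfield F}

lemma Finsupp.card_Iic_eq_prod (a : Fin m →₀ ℕ) :
    (Finset.Iic a).card = ∏ i, (a i + 1) := by
  rw [Finsupp.card_Iic, Finset.prod_subset (Finset.subset_univ _)]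
  · simp
  · intro i _ hi
    simp at hi
    simp [hi]

lemma Finsupp.eq_zero_or_single_of_degree_le_one {σ : Type*} {c : σ →₀ ℕ} (hc : c.degree ≤ 1) :
    c = 0 ∨ ∃ l, c = Finsupp.single l 1 := by
  classical
  by_cases h : c = 0
  · exact Or.inl h
  · right
    obtain ⟨l, hl⟩ := Finsupp.ne_iff.mp h
    obtain ⟨e, rfl⟩ := exists_add_of_le
      (Finsupp.single_le_iff.mpr (Nat.one_le_iff_ne_zero.mpr hl) : Finsupp.single l 1 ≤ c)
    refine ⟨l, ?_⟩
    rw [map_add, Finsupp.degree_single] at hc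
    rw [(Finsupp.degree_eq_zero_iff e).mp (by omega), add_zero]

/-- If all standard monomials divide `x ^ a`, the coordinates outside of the support of `a` are
affine functions of those in the support. -/
lemma exists_affine_relation {S : Set ((i : Fin m) → A i)} {a : Fin m →₀ ℕ}
    (ha : ∀ b, IsStandard F MonomialOrder.degLex (coordOn S) b → b ≤ a) (i : Fin m) :
    ∃ (γ : F) (α : Fin m → F), ∀ P ∈ S, (P i : F) = γ + ∑ l ∈ a.support, α l * (P l : F) := by
  classical
  have h := monomialValue_mem_span_standard (K := F) (ord := MonomialOrder.degLex)
    (x := coordOn S) (Finsupp.single i 1)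
  -- In degLex the monomials up to `x_i` have degree at most one. Being below `a`, such a variable
  -- has its index in the support of `a`.
  have hsub : monomialValue (coordOn S) '' {c | IsStandard F MonomialOrder.degLex (coordOn S) c ∧
      MonomialOrder.degLex.toSyn c ≤ MonomialOrder.degLex.toSyn (Finsupp.single i 1)} ⊆
      insert 1 (coordOn S '' (a.support : Set (Fin m))) := by
    rintro _ ⟨c, ⟨hc, hci⟩, rfl⟩
    have hdeg : c.degree ≤ 1 := by
      have := Finsupp.DegLex.monotone_degree (MonomialOrder.degLex_le_iff.mp hci)
      simpa using this
    rcases Finsupp.eq_zero_or_single_of_degree_le_one hdeg with rfl | ⟨l, rfl⟩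
    · left; simp
    · right
      refine ⟨l, ?_, by simp⟩
      have := ha _ hc l
      simp only [Finsupp.single_eq_same] at this
      simp only [Finset.mem_coe, Finsupp.mem_support_iff]
      omega
  have h := Submodule.span_mono hsub h
  obtain ⟨γ, z, hz, hx⟩ := Submodule.mem_span_insert.mp h
  obtain ⟨c, rfl⟩ := (Submodule.mem_span_image_finset_iff_exists_fun F).mp hz
  refine ⟨γ, fun l => if h : l ∈ a.support then c ⟨l, h⟩ else 0, fun P hP => ?_⟩
  have hP' := congrFun hx ⟨P, hP⟩
  rw [monomialValue_single, pow_one] at hP'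
  simp only [Pi.add_apply, Pi.smul_apply, Pi.one_apply, smul_eq_mul, mul_one, Finset.sum_apply]
    at hP'
  rw [← Finset.sum_coe_sort]
  refine hP'.trans (congrArg (γ + ·) (Finset.sum_congr rfl fun l _ => ?_))
  beta_reduce
  rw [dif_pos l.2]
  rfl

variable [Finite F]

lemma IsStandard.coordOn_lt {S : Set ((i : Fin m) → A i)} {ord : MonomialOrder (Fin m)}
    {b : Fin m →₀ ℕ} (hb : IsStandard F ord (coordOn S) b) (i : Fin m) :
    b i < Nat.card (A i) :=
  hb.lt_of_pow_eq (A i).two_le_natCard (by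
    ext P
    exact Subfield.pow_natCard (P.1 i).2)

/-- Otherwise the word would be orthogonal to all standard monomials: to those of degree below `v`
because of its own degree, to the others by assumption. -/
lemma exists_standard_sum_ne_zero [∀ i, Fintype (A i)] (ord : MonomialOrder (Fin m)) {u v : ℕ}
    (huv : u + v = ∑ i, (Nat.card (A i) - 1)) {S : Set ((i : Fin m) → A i)}
    {f : ((i : Fin m) → A i) → F} (hf : f ∈ polyWords A u) (hfS : Function.support f ⊆ S)
    (hf0 : f ≠ 0) : ∃ b, IsStandard F ord (coordOn S) b ∧ v ≤ ∑ i, b i ∧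
      ∑ P : (i : Fin m) → A i, f P * ∏ i, (P i : F) ^ b i ≠ 0 := by
  classical
  have := Fintype.ofFinite S
  by_contra! hcon
  apply hf0
  have h := eq_zero_of_orthogonal_standard ord S (fun P => f P) fun b hb => by
    rw [sum_support_mul hfS]
    by_cases hv : v ≤ ∑ i, b i
    · exact hcon b hb hv
    · exact sum_mul_prod_pow_eq_zero hf b (by omega)
  ext P
  by_contra hP
  exact hP (congrFun h ⟨P, hfS hP⟩)

/-- The whole box below `a` is standard, hence independent in `F^S`, whose dimension is `|S|`. If
the box already has `|S|` elements, there is no room for a further standard monomial. -/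
lemma prod_succ_le_ncard_of_isStandard {S : Set ((i : Fin m) → A i)} {a : Fin m →₀ ℕ}
    {ord : MonomialOrder (Fin m)} (ha : IsStandard F ord (coordOn S) a) :
    ∏ i, (a i + 1) ≤ S.ncard ∧ (∏ i, (a i + 1) = S.ncard →
      ∀ b, IsStandard F ord (coordOn S) b → b ≤ a) := by
  classical
  have := Fintype.ofFinite S
  have hfin : Module.finrank F (S → F) = S.ncard := by
    rw [Module.finrank_fintype_fun_eq_card, ← Nat.card_eq_fintype_card, Nat.card_coe_set_eq]
  have hIic : ∀ b ∈ Finset.Iic a, IsStandard F ord (coordOn S) b := fun b hb =>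
    ha.of_le (Finset.mem_Iic.mp hb)
  rw [← Finsupp.card_Iic_eq_prod, ← hfin]
  refine ⟨card_standard_le _ hIic, fun heq b hb => ?_⟩
  by_contra hba
  have h := card_standard_le (insert b (Finset.Iic a)) (K := F) (ord := ord) (x := coordOn S) (by
    intro c hc
    rcases Finset.mem_insert.mp hc with rfl | hc
    exacts [hb, hIic c hc])
  rw [Finset.card_insert_of_notMem (by simpa using hba)] at h
  omega

/-- Lower bound for the weight of words of degree at most `u = ∑_{i ≤ j} (d_i - 1)`, and the
structure of the support in the case of equality: it lies in the graph of an affine map on the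
coordinates in a set `T`, and words with this support are proportional. -/
theorem ncard_support_of_mem_polyWords (j : Fin m)
    (hle : ∀ i ≤ j, Nat.card (A i) ≤ Nat.card (A j))
    (hge : ∀ i, j < i → Nat.card (A j) ≤ Nat.card (A i))
    {f : ((i : Fin m) → A i) → F}
    (hf : f ∈ polyWords A (∑ i ∈ Finset.Iic j, (Nat.card (A i) - 1))) (hf0 : f ≠ 0) :
    ∏ i ∈ Finset.Ioi j, Nat.card (A i) ≤ (Function.support f).ncard ∧
      ((Function.support f).ncard = ∏ i ∈ Finset.Ioi j, Nat.card (A i) →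
        ∃ T : Finset (Fin m), (∏ i ∈ T, Nat.card (A i) = (Function.support f).ncard) ∧
          (∀ i ∈ T, Nat.card (A j) ≤ Nat.card (A i)) ∧
          (∀ i ∉ T, Nat.card (A i) ≤ Nat.card (A j)) ∧
          (∀ i ∉ T, ∃ (γ : F) (α : Fin m → F), ∀ P ∈ Function.support f,
            (P i : F) = γ + ∑ l ∈ T, α l * (P l : F)) ∧
          ∀ g ∈ polyWords A (∑ i ∈ Finset.Iic j, (Nat.card (A i) - 1)),
            Function.support g = Function.support f → ∃ c : F, f = c • g) := by
  classical
  have (i : Fin m) := Fintype.ofFinite (A i)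
  have hcard : ∀ i, 2 ≤ Nat.card (A i) := fun i => (A i).two_le_natCard
  have huv : ∑ i ∈ Finset.Iic j, (Nat.card (A i) - 1) + ∑ i ∈ Finset.Ioi j, (Nat.card (A i) - 1) =
      ∑ i, (Nat.card (A i) - 1) := by
    rw [← Finset.sum_union]
    · congr 1
      ext i
      simp [le_or_gt]
    · rw [Finset.disjoint_left]
      intro i
      simp
  obtain ⟨a, hstd, hva, hfa⟩ :=
    exists_standard_sum_ne_zero MonomialOrder.degLex huv hf subset_rfl hf0
  have hbox := prod_succ_le_of_sum_le (D := fun i => Nat.card (A i) - 1) (a := a)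
    (e := Nat.card (A j) - 1) (by have := hcard j; omega) (H := Finset.Ioi j)
    (fun i hi => Nat.sub_le_sub_right (hge i (Finset.mem_Ioi.mp hi)) 1)
    (fun i hi => Nat.sub_le_sub_right (hle i (by simpa using hi)) 1)
    (fun i => by have := hstd.coordOn_lt i; omega) hva
  simp only [Nat.sub_add_cancel ((one_le_two).trans (hcard _))] at hbox
  have hS := prod_succ_le_ncard_of_isStandard hstd
  refine ⟨hbox.1.trans hS.1, fun heq => ?_⟩
  have heqa : ∏ i, (a i + 1) = (Function.support f).ncard :=
    le_antisymm hS.1 (heq ▸ hbox.1)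
  obtain ⟨hsum, hai⟩ := hbox.2 (heqa.trans heq).symm
  have hle_a := hS.2 heqa
  refine ⟨a.support, ?_, ?_, ?_, fun i _ => exists_affine_relation hle_a i, ?_⟩
  · rw [← heqa, ← Finset.prod_subset (Finset.subset_univ a.support)]
    · refine Finset.prod_congr rfl fun i hi => ?_
      have h1 := (hai i).1.resolve_left (Finsupp.mem_support_iff.mp hi)
      have := hcard i
      omega
    · intro i _ hi
      simp [Finsupp.notMem_support_iff.mp hi]
  · intro i hi
    have h1 := Finsupp.mem_support_iff.mp hi
    by_contra! hlt
    exact h1 ((hai i).2.1 (by have := hcard i; omega))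
  · intro i hi
    have h1 := Finsupp.notMem_support_iff.mp hi
    by_contra! hlt
    have h2 := (hai i).2.2 (by have := hcard j; omega)
    have := hcard i
    omega
  · intro g hg hgf
    have hg0 : g ≠ 0 := by
      rintro rfl
      exact hf0 (Function.support_eq_empty_iff.mp (by simpa using hgf.symm))
    -- The pairing with `x^a` detects all these words: a standard `b` with `v ≤ ∑ b_i` satisfies `b
    -- ≤ a`, and `∑ a_i = v` forces `b = a`.
    have hunique : ∀ h ∈ polyWords A (∑ i ∈ Finset.Iic j, (Nat.card (A i) - 1)),
        Function.support h ⊆ Function.support f → h ≠ 0 →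
        ∑ P : (i : Fin m) → A i, h P * ∏ i, (P i : F) ^ a i ≠ 0 := by
      intro h hh hhf hh0
      obtain ⟨b, hb, hvb, hhb⟩ :=
        exists_standard_sum_ne_zero MonomialOrder.degLex huv hh hhf hh0
      have hba := hle_a b hb
      have : b = a := by
        ext i
        by_contra hne
        have hlt : ∑ i, b i < ∑ i, a i := Finset.sum_lt_sum (fun i _ => hba i)
          ⟨i, Finset.mem_univ i, lt_of_le_of_ne (hba i) hne⟩
        omega
      rwa [this] at hhb
    set x := ∑ P : (i : Fin m) → A i, f P * ∏ i, (P i : F) ^ a i with hx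
    set y := ∑ P : (i : Fin m) → A i, g P * ∏ i, (P i : F) ^ a i with hy
    have hy0 : y ≠ 0 := hunique g hg hgf.le hg0
    -- This combination has zero pairing with `x^a` by the choice of `x` and `y`.
    have hzero : y • f - x • g = 0 := by
      by_contra hne
      refine hunique _ (Submodule.sub_mem _ (Submodule.smul_mem _ _ hf)
        (Submodule.smul_mem _ _ hg)) ?_ hne ?_
      · intro P hP
        by_contra hPf
        have hPg : P ∉ Function.support g := hgf ▸ hPf
        rw [Function.notMem_support] at hPf hPg
        exact hP (by simp [hPf, hPg])
      · simp only [Pi.sub_apply, Pi.smul_apply, smul_eq_mul, sub_mul, mul_assoc,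
          Finset.sum_sub_distrib, ← Finset.mul_sum]
        rw [← hx, ← hy]
        ring
    refine ⟨y⁻¹ * x, ?_⟩
    rw [mul_smul, ← sub_eq_zero.mp hzero, smul_smul, inv_mul_cancel₀ hy0, one_smul]

end SmallWeight

/-! ### Flats -/

section Flats

variable {F : Type*} [Field F] {m n : ℕ} {A : Fin m → Subfield F} {K : Subfield F}
  {ι : Fin n → Fin m} (hK : ∀ t, A (ι t) = K) (H : Finset (Fin m))

/-- The coordinates of a point at the positions `ι t`. -/
def blockPart : ((i : Fin m) → A i) →+ (Fin n → K) where
  toFun P t := ⟨P (ι t), hK t ▸ (P (ι t)).2⟩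
  map_zero' := rfl
  map_add' _ _ := rfl

@[simp]
lemma coe_blockPart (P : (i : Fin m) → A i) (t : Fin n) :
    (blockPart hK P t : F) = P (ι t) := rfl

/-- The points with prescribed coordinates over `H` whose block coordinates lie in a given coset
of `W`. -/
def flat (p : (i : H) → A i) (W : Submodule K (Fin n → K)) (v : (Fin n → K) ⧸ W) :
    Set ((i : Fin m) → A i) :=
  {P | (fun i : H => P i) = p ∧ W.mkQ (blockPart hK P) = v}

variable {H}

lemma exists_headPart_blockPart (hι : Function.Injective ι) (hH : ∀ t, ι t ∉ H)
    (p : (i : H) → A i) (w : Fin n → K) :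
    ∃ P : (i : Fin m) → A i, (fun i : H => P i) = p ∧ blockPart hK P = w := by
  classical
  refine ⟨fun i => if h : i ∈ H then p ⟨i, h⟩ else
    if h' : ∃ t, ι t = i then ⟨w h'.choose, by
      have := hK h'.choose
      rw [h'.choose_spec] at this
      rw [this]; exact (w _).2⟩ else 0, ?_, ?_⟩
  · ext i
    simp
  · ext t
    have h' : ∃ t', ι t' = ι t := ⟨t, rfl⟩
    rw [coe_blockPart]
    simp only [hH t, dite_false, h', dite_true]
    rw [hι h'.choose_spec]

lemma flat_nonempty (hι : Function.Injective ι) (hH : ∀ t, ι t ∉ H) (p : (i : H) → A i)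
    (W : Submodule K (Fin n → K)) (v : (Fin n → K) ⧸ W) : (flat hK H p W v).Nonempty := by
  obtain ⟨w, rfl⟩ := W.mkQ_surjective v
  obtain ⟨P, hP, rfl⟩ := exists_headPart_blockPart hK hι hH p w
  exact ⟨P, hP, rfl⟩

lemma flat_injective (hι : Function.Injective ι) (hH : ∀ t, ι t ∉ H)
    {p p' : (i : H) → A i} {W W' : Submodule K (Fin n → K)} {v : (Fin n → K) ⧸ W}
    {v' : (Fin n → K) ⧸ W'} (h : flat hK H p W v = flat hK H p' W' v') :
    p = p' ∧ W = W' ∧ HEq v v' := by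
  obtain ⟨w, rfl⟩ := W.mkQ_surjective v
  obtain ⟨P, hP, rfl⟩ := exists_headPart_blockPart hK hι hH p w
  have hPm : P ∈ flat hK H p' W' v' := h ▸ (⟨hP, rfl⟩ : P ∈ flat hK H p W _)
  obtain ⟨hp, rfl⟩ := hPm
  obtain rfl : p = p' := hP.symm.trans hp
  have hmem : ∀ x, x ∈ W ↔ x ∈ W' := by
    intro x
    obtain ⟨Q, hQ, hQx⟩ := exists_headPart_blockPart hK hι hH p (x + blockPart hK P)
    have := Set.ext_iff.mp h Q
    simpa [flat, hQ, hQx] using this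
  obtain rfl : W = W' := Submodule.ext hmem
  exact ⟨rfl, rfl, HEq.rfl⟩

/-- The flats for fixed `W` are the fibres of a surjective additive homomorphism, so they all have
the same size. The product form avoids division. -/
lemma ncard_flat_mul [Finite F] (hι : Function.Injective ι) (hH : ∀ t, ι t ∉ H)
    (p : (i : H) → A i) (W : Submodule K (Fin n → K)) (v : (Fin n → K) ⧸ W) :
    (flat hK H p W v).ncard * ((∏ i ∈ H, Nat.card (A i)) * Nat.card ((Fin n → K) ⧸ W)) =
      ∏ i, Nat.card (A i) := by
  classical
  have := Fintype.ofFinite ((i : Fin m) → A i)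
  have : Finite ((Fin n → K) ⧸ W) := Finite.of_surjective _ W.mkQ_surjective
  have := Fintype.ofFinite (((i : H) → A i) × ((Fin n → K) ⧸ W))
  let φ : ((i : Fin m) → A i) →+ ((i : H) → A i) × ((Fin n → K) ⧸ W) :=
    { toFun := fun P => (fun i => P i, W.mkQ (blockPart hK P))
      map_zero' := by simp; rfl
      map_add' := fun P Q => by simp; rfl }
  have hsurj : Function.Surjective φ := by
    rintro ⟨q, x⟩
    obtain ⟨P, hP⟩ := flat_nonempty hK hι hH q W x
    exact ⟨P, Prod.ext hP.1 hP.2⟩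
  have hfib : ∀ y, (Finset.univ.filter fun P => φ P = y).card = (flat hK H p W v).ncard := by
    intro y
    rw [AddMonoidHom.card_fiber_eq_of_mem_range φ (hsurj y) (hsurj (p, v)), ← Set.ncard_coe_finset]
    congr 1
    ext P
    simp [flat, φ, Prod.ext_iff]
  have h := Finset.card_eq_sum_card_fiberwise (f := φ) (s := Finset.univ) (t := Finset.univ)
    fun _ _ => by simp
  simp only [hfib, Finset.sum_const, smul_eq_mul, Finset.card_univ, ← Nat.card_eq_fintype_card,
    Nat.card_prod, Nat.card_pi] at h
  rw [Finset.prod_coe_sort H fun i => Nat.card (A i)] at h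
  rw [h, mul_comm]

/-- The word with value `1` on a flat and `0` elsewhere. -/
noncomputable def flatWord (p : (i : H) → A i) (W : Submodule K (Fin n → K))
    (v : (Fin n → K) ⧸ W) : ((i : Fin m) → A i) → F :=
  (flat hK H p W v).indicator 1

@[simp]
lemma support_flatWord (p : (i : H) → A i) (W : Submodule K (Fin n → K))
    (v : (Fin n → K) ⧸ W) : Function.support (flatWord hK p W v) = flat hK H p W v := by
  simp [flatWord, Set.indicator, Function.support]

lemma linear_blockPart_mem_polyWords (φ : (Fin n → K) →ₗ[K] K) :
    (fun P => (φ (blockPart hK P) : F)) ∈ polyWords A 1 := by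
  have h : (fun P : (i : Fin m) → A i => (φ (blockPart hK P) : F)) =
      ∑ t, (φ (fun t' => if t = t' then 1 else 0) : F) •
        (fun P : (i : Fin m) → A i => (P (ι t) : F)) := by
    ext P
    rw [LinearMap.pi_apply_eq_sum_univ φ]
    simp [mul_comm]
  rw [h]
  exact Submodule.sum_mem _ fun t _ => Submodule.smul_mem _ _ (coord_mem_polyWords _)

lemma one_sub_sub_pow_mem_polyWords {f : ((i : Fin m) → A i) → F} (hf : f ∈ polyWords A 1)
    (c : F) (e : ℕ) : (1 - (f - fun _ => c) ^ e) ∈ polyWords A e := by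
  refine Submodule.sub_mem _ (polyWords_mono (Nat.zero_le _) one_mem_polyWords) ?_
  simpa using pow_mem_polyWords
    (Submodule.sub_mem _ hf (polyWords_mono zero_le_one (const_mem_polyWords c))) e

theorem flatWord_mem_polyWords [Finite F] (p : (i : H) → A i) (W : Submodule K (Fin n → K))
    (v : (Fin n → K) ⧸ W) : flatWord hK p W v ∈ polyWords A (∑ i ∈ H, (Nat.card (A i) - 1) +
      Module.finrank K ((Fin n → K) ⧸ W) * (Nat.card K - 1)) := by
  classical
  -- Coordinates on the quotient turn membership in the coset into as many linear equations over `K`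
  -- as the codimension of `W`; each costs degree `|K| - 1`.
  set e := (Module.finBasis K ((Fin n → K) ⧸ W)).equivFun
  let lin (t) : (Fin n → K) →ₗ[K] K := LinearMap.proj t ∘ₗ e.toLinearMap ∘ₗ W.mkQ
  have h : flatWord hK p W v =
      (∏ i : H, (1 - ((fun P : (i : Fin m) → A i => (P i : F)) - fun _ => (p i : F)) ^
        (Nat.card (A i) - 1))) *
      ∏ t, (1 - ((fun P => (lin t (blockPart hK P) : F)) - fun _ => (e v t : F)) ^
        (Nat.card K - 1)) := by
    ext P
    simp only [Pi.mul_apply, Finset.prod_apply, Pi.sub_apply, Pi.one_apply, Pi.pow_apply]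
    have h1 : ∀ i : H, 1 - ((P i : F) - p i) ^ (Nat.card (A i) - 1) =
        if (P i : F) - p i = 0 then 1 else 0 := fun i =>
      Subfield.one_sub_pow_natCard_sub_one (Subfield.sub_mem _ (P i).2 (p i).2)
    have h2 : ∀ t, 1 - ((lin t (blockPart hK P) : F) - e v t) ^ (Nat.card K - 1) =
        if (lin t (blockPart hK P) : F) - e v t = 0 then 1 else 0 := fun t =>
      Subfield.one_sub_pow_natCard_sub_one
        (Subfield.sub_mem _ (lin t (blockPart hK P)).2 (e v t).2)
    simp only [h1, h2]
    have h3 : (fun i : H => P i) = p ↔ ∀ i : H, (P i : F) = p i := by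
      simp only [funext_iff, Subtype.ext_iff]
    have h4 : W.mkQ (blockPart hK P) = v ↔ ∀ t, (lin t (blockPart hK P) : F) = e v t := by
      rw [← e.injective.eq_iff, funext_iff]
      simp only [Subtype.ext_iff]
      rfl
    have h5 : P ∈ flat hK H p W v ↔ (∀ i ∈ Finset.univ, (P (i : H) : F) - p i = 0) ∧
        ∀ t ∈ Finset.univ, (lin t (blockPart hK P) : F) - e v t = 0 := by
      simp only [sub_eq_zero, Finset.mem_univ, true_imp_iff]
      exact and_congr h3 h4
    rw [Finset.prod_boole, Finset.prod_boole, ite_zero_mul_ite_zero, mul_one, flatWord]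
    by_cases hP : P ∈ flat hK H p W v
    · rw [Set.indicator_of_mem hP, if_pos (h5.mp hP), Pi.one_apply]
    · rw [Set.indicator_of_notMem hP, if_neg (h5.not.mp hP)]
  rw [h]
  refine mul_mem_polyWords ?_ ?_
  · rw [← Finset.sum_coe_sort]
    exact prod_mem_polyWords _ fun i _ => one_sub_sub_pow_mem_polyWords (coord_mem_polyWords _) _ _
  · have := prod_mem_polyWords (A := A) Finset.univ
      fun t _ => one_sub_sub_pow_mem_polyWords (linear_blockPart_mem_polyWords hK (lin t)) (e v t)
        (Nat.card K - 1)
    simpa using this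

end Flats

/-! ### Supports of minimum weight words are flats -/

section MinimumWeight

variable {F : Type*} [Field F] [Finite F] {m n : ℕ} {A : Fin m → Subfield F} {K : Subfield F}
  {ι : Fin n → Fin m} (hK : ∀ t, A (ι t) = K) {H : Finset (Fin m)}

/-- The block vectors whose extension by zero satisfies the homogeneous relations with
coefficients `α` outside of `T`. -/
noncomputable def relationSpace (hι : Function.Injective ι) (K : Subfield F) (T : Finset (Fin m))
    (α : Fin m → Fin m → F) : Submodule K (Fin n → K) where
  carrier := {w | ∀ i ∉ T, Function.extend ι (fun t => (w t : F)) 0 i =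
    ∑ l ∈ T, α i l * Function.extend ι (fun t => (w t : F)) 0 l}
  zero_mem' i _ := by
    have : Function.extend ι (fun t => (((0 : Fin n → K) t : K) : F)) 0 = 0 := by
      ext l
      by_cases h : ∃ t, ι t = l
      · obtain ⟨t, rfl⟩ := h
        simp [hι.extend_apply]
      · simp [Function.extend_apply' _ _ _ h]
    rw [this]
    simp
  add_mem' {w w'} hw hw' i hi := by
    have : Function.extend ι (fun t => ((w + w') t : F)) 0 =
        Function.extend ι (fun t => (w t : F)) 0 + Function.extend ι (fun t => (w' t : F)) 0 := by
      ext l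
      by_cases h : ∃ t, ι t = l
      · obtain ⟨t, rfl⟩ := h
        simp [hι.extend_apply]
      · simp [Function.extend_apply' _ _ _ h]
    rw [this]
    simp only [Pi.add_apply, mul_add, Finset.sum_add_distrib]
    rw [hw i hi, hw' i hi]
  smul_mem' c w hw i hi := by
    have : Function.extend ι (fun t => ((c • w) t : F)) 0 =
        (c : F) • Function.extend ι (fun t => (w t : F)) 0 := by
      ext l
      by_cases h : ∃ t, ι t = l
      · obtain ⟨t, rfl⟩ := h
        simp [hι.extend_apply]
      · simp [Function.extend_apply' _ _ _ h]
    rw [this]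
    simp only [Pi.smul_apply, smul_eq_mul, mul_left_comm _ (c : F), ← Finset.mul_sum]
    rw [hw i hi]

/-- A set of the size of `∏_{l ∈ T} A_l` that lies in the graph of an affine map on the
coordinates over `T` projects onto these coordinates. -/
lemma exists_mem_eq_on_of_affine_relation {S : Set ((i : Fin m) → A i)} {T : Finset (Fin m)}
    (hcard : ∏ i ∈ T, Nat.card (A i) = S.ncard) {γ : Fin m → F} {α : Fin m → Fin m → F}
    (hrel : ∀ i ∉ T, ∀ P ∈ S, (P i : F) = γ i + ∑ l ∈ T, α i l * (P l : F))
    (y : (i : Fin m) → A i) : ∃ Q ∈ S, ∀ l ∈ T, Q l = y l := by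
  classical
  let π : S → ((l : T) → A l) := fun P l => P.1 l
  have hinj : Function.Injective π := by
    intro P Q hPQ
    have hT : ∀ l ∈ T, P.1 l = Q.1 l := fun l hl => congrFun hPQ ⟨l, hl⟩
    ext i
    by_cases hi : i ∈ T
    · rw [hT i hi]
    · rw [hrel i hi P P.2, hrel i hi Q Q.2]
      exact congrArg _ (Finset.sum_congr rfl fun l hl => by rw [hT l hl])
  have hbij : Function.Bijective π := by
    rw [Nat.bijective_iff_injective_and_card]
    refine ⟨hinj, ?_⟩
    rw [Nat.card_coe_set_eq, ← hcard, Nat.card_pi, Finset.prod_coe_sort T fun i => Nat.card (A i)]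
  obtain ⟨Q, hQ⟩ := hbij.2 fun l => y l
  exact ⟨Q, Q.2, fun l hl => congrFun hQ ⟨l, hl⟩⟩

/-- The coefficients of coordinates with more values than the dependent one vanish. -/
lemma coeff_eq_zero_of_affine_relation {S : Set ((i : Fin m) → A i)} (hS : S.Nonempty)
    {T : Finset (Fin m)}
    (hcard : ∏ i ∈ T, Nat.card (A i) = S.ncard) {γ : Fin m → F} {α : Fin m → Fin m → F}
    (hrel : ∀ i ∉ T, ∀ P ∈ S, (P i : F) = γ i + ∑ l ∈ T, α i l * (P l : F))
    {i l : Fin m} (hi : i ∉ T) (hl : l ∈ T) (hil : Nat.card (A i) < Nat.card (A l)) :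
    α i l = 0 := by
  classical
  obtain ⟨P₀, -⟩ := hS
  by_contra hα
  choose Q hQS hQ using fun x : A l =>
    exists_mem_eq_on_of_affine_relation hcard hrel (Function.update P₀ l x)
  have hval : ∀ x : A l, (Q x i : F) =
      γ i + (α i l * (x : F) + ∑ l' ∈ T.erase l, α i l' * (P₀ l' : F)) := by
    intro x
    rw [hrel i hi _ (hQS x), ← Finset.add_sum_erase T _ hl, hQ x l hl, Function.update_self]
    congr 2
    refine Finset.sum_congr rfl fun l' hl' => ?_
    rw [hQ x l' (Finset.mem_of_mem_erase hl'), Function.update_of_ne (Finset.ne_of_mem_erase hl')]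
  have hinj : Function.Injective fun x : A l => Q x i := by
    intro x y hxy
    have h : (Q x i : F) = Q y i := congrArg Subtype.val hxy
    rw [hval, hval] at h
    exact Subtype.ext (mul_left_cancel₀ hα (add_right_cancel (add_left_cancel h)))
  exact absurd (Nat.card_le_card_of_injective _ hinj) (not_le.mpr hil)

/-- `T` contains no index of `H` and every index outside both `H` and the block. Comparing field
sizes removes all coefficients that would tie `H` to `T`, or the block to later coordinates; what
remains are relations within the block. -/
theorem exists_eq_flat_of_affine_relation (hι : Function.Injective ι)
    {d : ℕ} (hlow : ∀ i ∈ H, Nat.card (A i) < d)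
    (hhigh : ∀ i ∉ H, i ∉ Set.range ι → d < Nat.card (A i))
    {S : Set ((i : Fin m) → A i)} (hS : S.Nonempty) {T : Finset (Fin m)}
    (hcard : ∏ i ∈ T, Nat.card (A i) = S.ncard)
    (hT : ∀ i ∈ T, d ≤ Nat.card (A i)) (hT' : ∀ i ∉ T, Nat.card (A i) ≤ d)
    (hrel : ∀ i ∉ T, ∃ (γ : F) (α : Fin m → F), ∀ P ∈ S,
      (P i : F) = γ + ∑ l ∈ T, α l * (P l : F)) :
    ∃ p W v, S = flat hK H p W v := by
  classical
  have hrel' : ∀ i, ∃ (γ : F) (α : Fin m → F), i ∉ T → ∀ P ∈ S,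
      (P i : F) = γ + ∑ l ∈ T, α l * (P l : F) := by
    intro i
    by_cases hi : i ∈ T
    · exact ⟨0, 0, fun h => absurd hi h⟩
    · obtain ⟨γ, α, h⟩ := hrel i hi
      exact ⟨γ, α, fun _ => h⟩
  choose γ α hrel using hrel'
  have hα : ∀ {i l}, i ∉ T → l ∈ T → Nat.card (A i) < Nat.card (A l) → α i l = 0 := fun hi hl h =>
    coeff_eq_zero_of_affine_relation hS hcard hrel hi hl h
  obtain ⟨P₀, hP₀⟩ := hS
  refine ⟨fun i => P₀ i, relationSpace hι K T α, Submodule.mkQ _ (blockPart hK P₀), ?_⟩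
  -- By its size `S` is the whole graph, so the relations, here centred at `P₀`, also suffice for
  -- membership.
  have hmem : ∀ P, P ∈ S ↔ ∀ i ∉ T, (P i - P₀ i : F) = ∑ l ∈ T, α i l * (P l - P₀ l : F) := by
    intro P
    have hsub : ∀ i, ∑ l ∈ T, α i l * (P l - P₀ l : F) =
        ∑ l ∈ T, α i l * (P l : F) - ∑ l ∈ T, α i l * (P₀ l : F) := fun i => by
      simp only [mul_sub, Finset.sum_sub_distrib]
    constructor
    · intro hP i hi
      rw [hsub, hrel i hi P hP, hrel i hi P₀ hP₀]
      ring
    · intro h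
      obtain ⟨Q, hQ, hQP⟩ := exists_mem_eq_on_of_affine_relation hcard hrel P
      have : P = Q := by
        ext i
        by_cases hi : i ∈ T
        · rw [hQP i hi]
        · have h1 := h i hi
          rw [hsub] at h1
          have h2 := hrel i hi P₀ hP₀
          rw [hrel i hi Q hQ, Finset.sum_congr rfl fun l hl => by rw [hQP l hl]]
          linear_combination h1 + h2
      rwa [this]
  have hHT : ∀ i ∈ H, i ∉ T := fun i hi hiT => absurd (hT i hiT) (not_le.mpr (hlow i hi))
  have hhead : ∀ P ∈ S, (fun i : H => P i) = fun i : H => P₀ i := by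
    intro P hP
    ext i
    have h := (hmem P).mp hP i (hHT i i.2)
    rw [Finset.sum_eq_zero fun l hl => by
      rw [hα (hHT i i.2) hl ((hlow i i.2).trans_le (hT l hl)), zero_mul]] at h
    exact sub_eq_zero.mp h
  ext P
  have hblock : ∀ t, (((blockPart hK P - blockPart hK P₀) t : K) : F) = P (ι t) - P₀ (ι t) :=
    fun t => rfl
  have key : (fun i : H => P i) = (fun i : H => P₀ i) →
      (P ∈ S ↔ blockPart hK P - blockPart hK P₀ ∈ relationSpace hι K T α) := by
    intro hPH
    rw [hmem]
    have hval : ∀ i, (i ∈ H ∨ i ∈ Set.range ι) → Function.extend ι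
        (fun t => (((blockPart hK P - blockPart hK P₀) t : K) : F)) 0 i = P i - P₀ i := by
      intro i hi
      by_cases hr : ∃ t, ι t = i
      · obtain ⟨t, rfl⟩ := hr
        rw [hι.extend_apply, hblock]
      · have hiH := hi.resolve_right hr
        rw [Function.extend_apply' _ _ _ hr, congrFun hPH ⟨i, hiH⟩]
        simp
    refine forall₂_congr fun i hi => ?_
    -- An index outside both `H` and the block has a field larger than `d`, hence lies in `T`.
    rw [hval i (by
      by_contra! hcon
      exact absurd (hT' i hi) (not_le.mpr (hhigh i hcon.1 hcon.2)))]
    rw [Finset.sum_congr rfl fun l hl => ?_]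
    by_cases hlr : l ∈ H ∨ l ∈ Set.range ι
    · rw [hval l hlr]
    · push Not at hlr
      rw [hα hi hl ((hT' i hi).trans_lt (hhigh l hlr.1 hlr.2)), zero_mul, zero_mul]
  simp only [flat, Submodule.mkQ_apply, Submodule.Quotient.eq]
  exact ⟨fun hP => ⟨hhead P hP, (key (hhead P hP)).mp hP⟩, fun hP => (key hP.1).mpr hP.2⟩

end MinimumWeight

/-! ### Counting -/

section Counting

lemma wordWeight_eq_ncard_support {ι F : Type*} [Finite ι] [Zero F] (c : ι → F) :
    wordWeight c = (Function.support c).ncard := by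
  classical
  unfold wordWeight hammingNorm
  rw [← Set.ncard_coe_finset]
  congr 1
  ext i
  simp

/-- There are as many subspaces of codimension `k` as of dimension `k`. -/
theorem card_finrank_quotient_eq_gaussianBinomial (K : Type*) [Field K] (n k : ℕ) :
    Nat.card {W : Submodule K (Fin n → K) // Module.finrank K ((Fin n → K) ⧸ W) = k} =
      gaussianBinomial K n k := by
  have e : Module.Dual K (Fin n → K) ≃ₗ[K] (Fin n → K) :=
    (Pi.basisFun K (Fin n)).toDualEquiv.symm
  -- Annihilators exchange dimension and codimension; a basis identifies the dual with the space
  -- itself.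
  let Φ : Submodule K (Fin n → K) ≃ Submodule K (Module.Dual K (Fin n → K)) :=
    { toFun := fun W => W.dualAnnihilator
      invFun := fun U => U.dualCoannihilator
      left_inv := fun W => Subspace.dualAnnihilator_dualCoannihilator_eq
      right_inv := fun U => Subspace.dualCoannihilator_dualAnnihilator_eq }
  have hΦ : ∀ W, Module.finrank K (Φ W) = Module.finrank K ((Fin n → K) ⧸ W) := fun W =>
    (Submodule.dualQuotEquivDualAnnihilator W).finrank_eq.symm.trans Subspace.dual_finrank_eq
  have he : ∀ U, Module.finrank K ((Submodule.orderIsoMapComap e).toEquiv U) =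
      Module.finrank K U := fun U => LinearEquiv.finrank_map_eq e U
  refine Nat.card_congr
    ((Φ.trans (Submodule.orderIsoMapComap e).toEquiv).subtypeEquiv fun W => ?_)
  rw [Equiv.trans_apply, he, hΦ]

lemma exists_finrank_quotient_eq (K : Type*) [Field K] {n k : ℕ} (hkn : k ≤ n) :
    ∃ W : Submodule K (Fin n → K), Module.finrank K ((Fin n → K) ⧸ W) = k := by
  refine ⟨LinearMap.ker (LinearMap.funLeft K K (Fin.castLE hkn)), ?_⟩
  rw [(LinearMap.quotKerEquivOfSurjective _
    (LinearMap.funLeft_surjective_of_injective K K _ (Fin.castLE_injective hkn))).finrank_eq]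
  simp

variable {F : Type*} [Field F] {m n : ℕ} {A : Fin m → Subfield F} {K : Subfield F}
  {ι : Fin n → Fin m} (hK : ∀ t, A (ι t) = K) {H : Finset (Fin m)}

variable (H) in
/-- The parameters of the minimum weight words. -/
abbrev FlatData (A : Fin m → Subfield F) (K : Subfield F) (n k : ℕ) : Type _ :=
  Fˣ × ((i : H) → A i) ×
    (Σ W : {W : Submodule K (Fin n → K) // Module.finrank K ((Fin n → K) ⧸ W) = k},
      (Fin n → K) ⧸ W.1)

/-- The word that is constant on a flat and `0` elsewhere. -/
noncomputable def FlatData.word {k : ℕ} (x : FlatData H A K n k) : ((i : Fin m) → A i) → F :=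
  (x.1 : F) • flatWord hK x.2.1 x.2.2.1.1 x.2.2.2

lemma FlatData.support_word {k : ℕ} (x : FlatData H A K n k) :
    Function.support (FlatData.word hK x) = flat hK H x.2.1 x.2.2.1.1 x.2.2.2 := by
  rw [FlatData.word, Function.support_const_smul_of_ne_zero _ _ x.1.ne_zero, support_flatWord]

lemma FlatData.word_injective (hι : Function.Injective ι) (hH : ∀ t, ι t ∉ H) {k : ℕ} :
    Function.Injective (FlatData.word hK : FlatData H A K n k → _) := by
  rintro ⟨c, p, ⟨W, hW⟩, v⟩ ⟨c', p', ⟨W', hW'⟩, v'⟩ h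
  have hs := congrArg Function.support h
  rw [FlatData.support_word, FlatData.support_word] at hs
  obtain ⟨rfl, rfl, hv⟩ := flat_injective hK hι hH hs
  obtain rfl := eq_of_heq hv
  obtain ⟨P, hP⟩ := flat_nonempty hK hι hH p W v
  have hc := congrFun h P
  simp only [FlatData.word, flatWord, Pi.smul_apply, smul_eq_mul] at hc
  rw [Set.indicator_of_mem hP] at hc
  obtain rfl : c = c' := Units.ext (by simpa using hc)
  rfl

lemma card_flatData [Finite F] (k : ℕ) : Nat.card (FlatData H A K n k) =
    (Nat.card F - 1) * ((∏ i ∈ H, Nat.card (A i)) * Nat.card K ^ k) *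
      gaussianBinomial K n k := by
  classical
  have hfin (W : Submodule K (Fin n → K)) : Finite ((Fin n → K) ⧸ W) :=
    Finite.of_surjective _ W.mkQ_surjective
  have := Fintype.ofFinite
    {W : Submodule K (Fin n → K) // Module.finrank K ((Fin n → K) ⧸ W) = k}
  have hq : ∀ W : {W : Submodule K (Fin n → K) // Module.finrank K ((Fin n → K) ⧸ W) = k},
      Nat.card ((Fin n → K) ⧸ W.1) = Nat.card K ^ k := fun W => by
    rw [Module.natCard_eq_pow_finrank (K := K), W.2]
  rw [Nat.card_prod, Nat.card_prod, Nat.card_units, Nat.card_pi, Nat.card_sigma,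
    Finset.prod_coe_sort H fun i => Nat.card (A i), Finset.sum_congr rfl fun W _ => hq W,
    Finset.sum_const, Finset.card_univ, ← Nat.card_eq_fintype_card,
    card_finrank_quotient_eq_gaussianBinomial, smul_eq_mul]
  ring

/-- Here `k` is the number of block coordinates up to `j`. By `hsum` and `hprod`, flats with `W` of
codimension `k` have the degree of the code and the size of the lower bound. -/
theorem ncard_minWeightWords [Finite F] (hK : ∀ t, A (ι t) = K) (hι : Function.Injective ι) (hH : ∀ t, ι t ∉ H) (j : Fin m)
    (hle : ∀ i ≤ j, Nat.card (A i) ≤ Nat.card (A j))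
    (hge : ∀ i, j < i → Nat.card (A j) ≤ Nat.card (A i))
    (hlow : ∀ i ∈ H, Nat.card (A i) < Nat.card (A j))
    (hhigh : ∀ i ∉ H, i ∉ Set.range ι → Nat.card (A j) < Nat.card (A i))
    {k : ℕ} (hkn : k ≤ n)
    (hprod : ∏ i ∈ Finset.Iic j, Nat.card (A i) = (∏ i ∈ H, Nat.card (A i)) * Nat.card K ^ k)
    (hsum : ∑ i ∈ Finset.Iic j, (Nat.card (A i) - 1) =
      ∑ i ∈ H, (Nat.card (A i) - 1) + k * (Nat.card K - 1)) :
    (minWeightWords (affineCartesianCode A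
      (∑ i ∈ Finset.Iic j, (Nat.card (A i) - 1)))).ncard =
      (Nat.card F - 1) * (∏ i ∈ Finset.Iic j, Nat.card (A i)) * gaussianBinomial K n k := by
  classical
  have hpos : ∀ s : Finset (Fin m), 0 < ∏ i ∈ s, Nat.card (A i) := fun s =>
    Finset.prod_pos fun i _ => Nat.card_pos
  have hall : (∏ i ∈ Finset.Iic j, Nat.card (A i)) * ∏ i ∈ Finset.Ioi j, Nat.card (A i) =
      ∏ i, Nat.card (A i) := by
    rw [← Finset.prod_union]
    · congr 1
      ext i
      simp [le_or_gt]
    · rw [Finset.disjoint_left]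
      intro i
      simp
  have hword : ∀ x : FlatData H A K n k,
      FlatData.word hK x ∈ polyWords A (∑ i ∈ Finset.Iic j, (Nat.card (A i) - 1)) ∧
      FlatData.word hK x ≠ 0 ∧
      (Function.support (FlatData.word hK x)).ncard = ∏ i ∈ Finset.Ioi j, Nat.card (A i) := by
    intro x
    refine ⟨?_, ?_, ?_⟩
    · have h := flatWord_mem_polyWords hK x.2.1 x.2.2.1.1 x.2.2.2
      rw [x.2.2.1.2, ← hsum] at h
      exact Submodule.smul_mem _ _ h
    · rw [← Function.support_nonempty_iff, FlatData.support_word]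
      exact flat_nonempty hK hι hH _ _ _
    · have h := ncard_flat_mul hK hι hH x.2.1 x.2.2.1.1 x.2.2.2
      rw [Module.natCard_eq_pow_finrank (K := K), x.2.2.1.2, ← hprod, ← hall, mul_comm] at h
      rw [FlatData.support_word]
      exact Nat.eq_of_mul_eq_mul_left (hpos _) h
  have hrange : minWeightWords (affineCartesianCode A
      (∑ i ∈ Finset.Iic j, (Nat.card (A i) - 1))) =
      Set.range (FlatData.word hK : FlatData H A K n k → _) := by
    rw [affineCartesianCode_eq_polyWords]
    ext f
    constructor
    · rintro ⟨hf, hf0, hmin⟩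
      obtain ⟨hlb, hstr⟩ := ncard_support_of_mem_polyWords j hle hge hf hf0
      -- One flat of codimension `k` shows that the lower bound for the weight is attained.
      obtain ⟨W₀, hW₀⟩ := exists_finrank_quotient_eq K hkn
      obtain ⟨h1, h2, h3⟩ := hword ⟨1, 0, ⟨W₀, hW₀⟩, 0⟩
      have hub := hmin _ h1 h2
      rw [wordWeight_eq_ncard_support, wordWeight_eq_ncard_support, h3] at hub
      have heq := le_antisymm hub hlb
      obtain ⟨T, hTc, hT, hT', hrel, hprop⟩ := hstr heq
      obtain ⟨p, W, v, hS⟩ := exists_eq_flat_of_affine_relation hK hι hlow hhigh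
        (Function.support_nonempty_iff.mpr hf0) hTc hT hT' hrel
      -- The size of the support determines the codimension, since `|K| ≥ 2`.
      have hW : Module.finrank K ((Fin n → K) ⧸ W) = k := by
        have h := ncard_flat_mul hK hι hH p W v
        rw [← hS, heq, ← hall, hprod, mul_comm] at h
        have h' := Nat.eq_of_mul_eq_mul_left (hpos H) (Nat.eq_of_mul_eq_mul_right (hpos _) h)
        rw [Module.natCard_eq_pow_finrank (K := K)] at h'
        exact Nat.pow_right_injective K.two_le_natCard h'
      have hg := flatWord_mem_polyWords hK p W v
      rw [hW, ← hsum] at hg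
      obtain ⟨c, hc⟩ := hprop _ hg ((support_flatWord hK p W v).trans hS.symm)
      have hc0 : c ≠ 0 := by
        rintro rfl
        exact hf0 (by rw [hc, zero_smul])
      exact ⟨⟨Units.mk0 c hc0, p, ⟨W, hW⟩, v⟩, hc.symm⟩
    · rintro ⟨x, rfl⟩
      obtain ⟨h1, h2, h3⟩ := hword x
      refine ⟨h1, h2, fun g hg hg0 => ?_⟩
      rw [wordWeight_eq_ncard_support, wordWeight_eq_ncard_support, h3]
      exact (ncard_support_of_mem_polyWords j hle hge hg hg0).1
  rw [hrange, hprod, ← card_flatData, ← Set.image_univ,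
    Set.ncard_image_of_injective _ (FlatData.word_injective hK hι hH), Set.ncard_univ]

end Counting

/-! ### Blocks of coordinates -/

section Blocks

variable {lam : ℕ} (μ : Fin lam → ℕ)

lemma partialSum_succ (t : Fin lam) :
    partialSum μ (t.val + 1) = partialSum μ t.val + μ t := by
  classical
  unfold partialSum
  have : (Finset.univ.filter fun i : Fin lam => i.val < t.val + 1) =
      insert t (Finset.univ.filter fun i : Fin lam => i.val < t.val) := by
    ext i
    simp only [Finset.mem_filter, Finset.mem_univ, true_and, Finset.mem_insert, Fin.ext_iff]
    omega
  rw [this, Finset.sum_insert (by simp), add_comm]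

lemma partialSum_mono : Monotone (partialSum μ) := by
  intro a b hab
  refine Finset.sum_le_sum_of_subset fun i hi => ?_
  simp only [Finset.mem_filter, Finset.mem_univ, true_and] at hi ⊢
  omega

lemma partialSum_last : partialSum μ lam = ∑ t, μ t := by
  simp [partialSum]

lemma exists_inBlock {m : ℕ} (hm : ∑ t, μ t = m) (i : Fin m) : ∃ t, InBlock μ t i := by
  have key : ∀ T ≤ lam, i.val < partialSum μ T → ∃ t, InBlock μ t i := by
    intro T
    induction T with
    | zero => intro _ h; simp [partialSum] at h
    | succ T ih =>
      intro hT h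
      by_cases h' : i.val < partialSum μ T
      · exact ih (by omega) h'
      · exact ⟨⟨T, hT⟩, not_lt.mp h', h⟩
  exact key lam le_rfl (by rw [partialSum_last, hm]; exact i.2)

lemma Subfield.natCard_lt_natCard {F : Type*} [Field F] [Finite F] {K L : Subfield F}
    (h : K < L) : Nat.card K < Nat.card L :=
  Set.ncard_lt_ncard (SetLike.coe_ssubset_coe.mpr h)

end Blocks

theorem mainTheorem2 {F : Type*} [Field F] [Finite F] {m lam : ℕ}
    (Fs : Fin lam → Subfield F) (hFs : StrictMono Fs)
    (μ : Fin lam → ℕ) (hμ : ∀ t, 0 < μ t) (hm : ∑ t, μ t = m)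
    (A : Fin m → Subfield F)
    (hA : ∀ (i : Fin m) (t : Fin lam), InBlock μ t i → A i = Fs t)
    (j : Fin m) (r : Fin lam) (hr : InBlock μ r j)
    (u : ℕ) (hu : u = ∑ i ∈ Finset.Iic j, (Nat.card (A i) - 1)) :
    (minWeightWords (affineCartesianCode A u)).ncard =
      (Nat.card F - 1) * (∏ i ∈ Finset.Iic j, Nat.card (A i)) *
        gaussianBinomial (A j) (μ r) (j.val + 1 - partialSum μ r.val) := by
  subst hu
  have hsj := hr.1
  have hjs := hr.2
  rw [partialSum_succ] at hjs
  have hend : partialSum μ r.val + μ r ≤ m := by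
    rw [← partialSum_succ, ← hm, ← partialSum_last]
    exact partialSum_mono μ r.2
  set s := partialSum μ r.val with hs
  have hAj : A j = Fs r := hA j r hr
  have hmid : ∀ i : Fin m, s ≤ i.val → i.val < s + μ r → A i = A j := fun i h1 h2 => by
    rw [hAj, hA i r ⟨h1, by rw [partialSum_succ]; exact h2⟩]
  have hlow : ∀ i : Fin m, i.val < s → Nat.card (A i) < Nat.card (A j) := by
    intro i hi
    obtain ⟨t, ht⟩ := exists_inBlock μ hm i
    rw [hA i t ht, hAj]
    refine Subfield.natCard_lt_natCard (hFs ?_)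
    by_contra! hrt
    have h1 : s ≤ partialSum μ t.val := partialSum_mono μ hrt
    have h2 := ht.1
    omega
  have hhigh : ∀ i : Fin m, s + μ r ≤ i.val → Nat.card (A j) < Nat.card (A i) := by
    intro i hi
    obtain ⟨t, ht⟩ := exists_inBlock μ hm i
    rw [hA i t ht, hAj]
    refine Subfield.natCard_lt_natCard (hFs ?_)
    by_contra! hrt
    have h1 : partialSum μ (t.val + 1) ≤ partialSum μ (r.val + 1) :=
      partialSum_mono μ (Nat.succ_le_succ hrt)
    rw [partialSum_succ μ r] at h1
    have h2 := ht.2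
    omega
  -- Counted from `0`, block `r` occupies the positions `s, …, s + μ r - 1`, and `j + 1 - s` of them
  -- are at most `j`.
  let s' : Fin m := ⟨s, by omega⟩
  let ι : Fin (μ r) → Fin m := fun t => ⟨s + t.val, by omega⟩
  have hsplit : Finset.Iic j = Finset.Iio s' ∪ Finset.Icc s' j := by
    ext i
    simp only [Finset.mem_Iic, Finset.mem_union, Finset.mem_Iio, Finset.mem_Icc, Fin.le_def,
      Fin.lt_def, s']
    omega
  have hdisj : Disjoint (Finset.Iio s') (Finset.Icc s' j) := by
    rw [Finset.disjoint_left]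
    intro i hi hi'
    exact absurd (Finset.mem_Iio.mp hi) (not_lt.mpr (Finset.mem_Icc.mp hi').1)
  have hIcc : ∀ i ∈ Finset.Icc s' j, Nat.card (A i) = Nat.card (A j) := by
    intro i hi
    rw [Finset.mem_Icc, Fin.le_def, Fin.le_def] at hi
    rw [hmid i hi.1 (by omega)]
  have hcard : (Finset.Icc s' j).card = j.val + 1 - s := Fin.card_Icc _ _
  refine ncard_minWeightWords (ι := ι) (K := A j) (H := Finset.Iio s')
    (fun t => hmid _ (by simp [ι]) (by simp [ι]))
    (fun t t' h => by simpa [ι, Fin.ext_iff] using h)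
    (fun t => by simp [ι, s', Fin.lt_def]) j ?_ ?_ ?_ ?_ (by omega) ?_ ?_
  · intro i hi
    by_cases h : i.val < s
    · exact (hlow i h).le
    · have : i.val ≤ j.val := hi
      rw [hmid i (by omega) (by omega)]
  · intro i hi
    by_cases h : s + μ r ≤ i.val
    · exact (hhigh i h).le
    · have : j.val < i.val := hi
      rw [hmid i (by omega) (by omega)]
  · intro i hi
    exact hlow i (Fin.lt_def.mp (Finset.mem_Iio.mp hi))
  · intro i hi hr'
    refine hhigh i ?_
    by_contra! hlt
    have hi' : s ≤ i.val := by simpa [s', Fin.le_def] using hi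
    exact hr' ⟨⟨i.val - s, by omega⟩, Fin.ext (by simp only [ι]; omega)⟩
  · rw [hsplit, Finset.prod_union hdisj, Finset.prod_congr rfl hIcc, Finset.prod_const, hcard]
  · have h : ∀ i ∈ Finset.Icc s' j, Nat.card (A i) - 1 = Nat.card (A j) - 1 := fun i hi => by
      rw [hIcc i hi]
    rw [hsplit, Finset.sum_union hdisj, Finset.sum_congr rfl h, Finset.sum_const, hcard,
      smul_eq_mul]
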